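/- Let $X$ be a real-valued random variable taking values (almost surely) in a set $\mathcal X\subseteq\mathbb R$, whose distribution has no singular continuous component, i.e., $P_X=P_X^{ac}+P_X^{d}$ with $P_X^{ac}$ absolutely continuous with respect to Lebesgue measure and $P_X^{d}$ concentrated on an at most countable set, and assume $0<P_X^{ac}(\mathcal X)\le 1$. Let $\mathcal X_1,\dots,\mathcal X_K$ be a finite partition of $\mathcal X$ into compact sets, let $g:\mathcal X\to\mathbb R$ be a bounded measurable function such that each restriction $g|_{\mathcal X_i}$ is injective or constant, and let $Y=g(X)$. For $n\in\mathbb N$ let $\hat X_n=\lfloor 2^nX\rfloor/2^n$, let $H(\hat X_n)$ be its entropy, and let $H(\hat X_n|Y)=\int H(\hat X_n|Y=y)\,dP_Y(y)$ be its conditional entropy given $Y$. Then $0<H(\hat X_n)<\infty$ for all sufficiently large $n$, and the relative information loss $l(X\to Y)=\lim_{n\to\infty}\frac{H(\hat X_n|Y)}{H(\hat X_n)}$ exists and equals \[ l(X\to Y)=\frac{P_X^{ac}(A)}{P_X^{ac}(\mathcal X)}, \] where $A$ is the union of those sets $\mathcal X_i$ on which $g$ is constant. -/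

import Mathlib

open MeasureTheory ProbabilityTheory Filter Topology
open scoped ENNReal

noncomputable section

namespace InfoLoss

/-- A measure is discrete if it is concentrated on a countable set. -/
def IsDiscrete {α : Type*} [MeasurableSpace α] (μ : Measure α) : Prop :=
  ∃ S : Set α, S.Countable ∧ μ Sᶜ = 0

open Classical in
/-- The entropy, in bits, of a probability law `μ`: it is `∑ x, μ {x} * log₂ (1 / μ {x})` (possibly
infinite) if `μ` is discrete, and infinite otherwise. -/
def entropy {α : Type*} [MeasurableSpace α] (μ : Measure α) : ℝ≥0∞ :=
  if IsDiscrete μ then ∑' x : α, ENNReal.ofReal (Real.negMulLog (μ.real {x}) / Real.log 2) else ⊤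

/-- The conditional entropy `H(Z | Y) = ∫ H(Z | Y = y) dP_Y(y)`, where `H(Z | Y = y)` is the entropy
of the regular conditional distribution of `Z` given `Y = y`. -/
def condEntropy {Ω : Type*} [MeasurableSpace Ω] (P : Measure Ω) [IsFiniteMeasure P]
    (Z Y : Ω → ℝ) : ℝ≥0∞ :=
  ∫⁻ y, entropy (condDistrib Z Y P y) ∂(P.map Y)

/-- The uniform quantizer with cells `[k / 2 ^ n, (k + 1) / 2 ^ n)`. -/
def quantize (n : ℕ) (x : ℝ) : ℝ := (⌊(2 : ℝ) ^ n * x⌋ : ℝ) / 2 ^ n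

/-- The relative information loss `l(X → Y)`, i.e. the limit of `H(X̂ₙ | Y) / H(X̂ₙ)` where `X̂ₙ` is
the quantization of `X`, exists and equals `l`. The quotients are required to be meaningful for
all large `n`. -/
def HasRelInfoLoss {Ω : Type*} [MeasurableSpace Ω] (P : Measure Ω) [IsFiniteMeasure P]
    (X Y : Ω → ℝ) (l : ℝ≥0∞) : Prop :=
  (∀ᶠ n : ℕ in atTop, 0 < entropy (P.map (fun ω => quantize n (X ω))) ∧
      entropy (P.map (fun ω => quantize n (X ω))) < ⊤) ∧
  Tendsto (fun n : ℕ => condEntropy P (fun ω => quantize n (X ω)) Y /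
      entropy (P.map (fun ω => quantize n (X ω)))) atTop (𝓝 l)

/-- `g` is constant on the set `s`. -/
def IsConstOn (g : ℝ → ℝ) (s : Set ℝ) : Prop := ∃ c : ℝ, ∀ x ∈ s, g x = c

end InfoLoss

end

namespace InfoLoss

/-! Numerator and denominator both grow linearly in `n`, and the slopes are masses of absolutely
continuous parts.

For a law `a + s` on `[-M, M]`, with `a` absolutely continuous and `s` discrete, the quantized
entropy over `n` tends to the mass of `a` (`tendsto_entropy_map_quantize_div`). Up to mass `ε`, `a`
has density at most `L`, so its cells have mass at most `L * 2⁻ⁿ` and cost about `n` bits per unit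
mass. Up to mass `ε`, `s` lives on finitely many points and costs a bounded amount.

For the numerator, let `C` be the finite set of values `g` takes on its constant pieces. At an atom
`y ∈ C` of `Y`, the law of `X` given `y` is the normalized restriction to the fibre, with slope `a
(g ⁻¹' {y})` once weighted by the atom. Off `C` the fibres have at most one point per piece, so
their entropy is bounded. The slopes add up to `a (g ⁻¹' C)`, which is the mass of `A`, since the
other pieces add only finitely many points. -/

/-! ### Inequalities for `-x log x`. -/

lemma negMulLog_le_one {x : ℝ} (hx : 0 ≤ x) : Real.negMulLog x ≤ 1 := by
  linarith [Real.negMulLog_le_one_sub_self hx]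

/-- Rescaling of `negMulLog_le_one` at `N * x`. Summed over at most `N` cells it bounds the entropy
by `1 + mass * log N`, without Jensen. -/
lemma negMulLog_le_inv_add {x N : ℝ} (hx : 0 ≤ x) (hN : 0 < N) :
    Real.negMulLog x ≤ N⁻¹ + x * Real.log N := by
  have h := negMulLog_le_one (mul_nonneg hN.le hx)
  rw [Real.negMulLog_mul] at h
  have h1 : Real.negMulLog N = -(N * Real.log N) := by rw [Real.negMulLog]; ring
  rw [h1] at h
  have h2 : N⁻¹ * (x * -(N * Real.log N) + N * Real.negMulLog x) ≤ N⁻¹ * 1 :=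
    mul_le_mul_of_nonneg_left h (by positivity)
  have h3 : N⁻¹ * (x * -(N * Real.log N) + N * Real.negMulLog x)
      = -(x * Real.log N) + Real.negMulLog x := by
    field_simp
  linarith

lemma negMulLog_add_le {x y : ℝ} (hx : 0 ≤ x) (hy : 0 ≤ y) :
    Real.negMulLog (x + y) ≤ Real.negMulLog x + Real.negMulLog y := by
  rcases hx.eq_or_lt with rfl | hx'
  · simp
  rcases hy.eq_or_lt with rfl | hy'
  · simp
  have h1 : Real.log x ≤ Real.log (x + y) := Real.log_le_log hx' (by linarith)
  have h2 : Real.log y ≤ Real.log (x + y) := Real.log_le_log hy' (by linarith)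
  simp only [Real.negMulLog]
  nlinarith

/-- Concavity at the midpoint of `x` and `y`. -/
lemma le_negMulLog_add {x y : ℝ} (hx : 0 ≤ x) (hy : 0 ≤ y) :
    Real.negMulLog x + Real.negMulLog y ≤ Real.negMulLog (x + y) + (x + y) * Real.log 2 := by
  have h := Real.concaveOn_negMulLog.2 (Set.mem_Ici.2 hx) (Set.mem_Ici.2 hy)
    (show (0 : ℝ) ≤ 2⁻¹ by norm_num) (show (0 : ℝ) ≤ 2⁻¹ by norm_num) (by norm_num)
  simp only [smul_eq_mul] at h
  rw [← mul_add 2⁻¹ x y, Real.negMulLog_mul] at h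
  have h1 : Real.negMulLog 2⁻¹ = 2⁻¹ * Real.log 2 := by rw [Real.negMulLog, Real.log_inv]; ring
  rw [h1] at h
  linarith

/-! ### The quantizer and the entropy of its cells. -/

lemma measurable_quantize (n : ℕ) : Measurable (quantize n) := by
  unfold quantize
  fun_prop

lemma quantize_le (n : ℕ) (x : ℝ) : quantize n x ≤ x := by
  rw [quantize, div_le_iff₀ (by positivity), mul_comm]
  exact Int.floor_le _

lemma le_quantize_add (n : ℕ) (x : ℝ) : x ≤ quantize n x + (2 ^ n)⁻¹ := by
  rw [quantize, ← one_div, ← add_div, le_div_iff₀ (by positivity), mul_comm]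
  exact (Int.lt_floor_add_one _).le

lemma volume_quantize_preimage_le (n : ℕ) (x : ℝ) :
    volume (quantize n ⁻¹' {x}) ≤ ENNReal.ofReal (2 ^ n)⁻¹ := by
  have : quantize n ⁻¹' {x} ⊆ Set.Icc x (x + (2 ^ n)⁻¹) := by
    rintro y rfl
    exact ⟨quantize_le n y, le_quantize_add n y⟩
  refine (measure_mono this).trans ?_
  rw [Real.volume_Icc]
  simp

/-- The values on `[-M, M]` of the quantizer with cells of length `2⁻ⁿ`. -/
noncomputable def quantizedValues (M n : ℕ) : Finset ℝ :=
  (Finset.Icc (-(M * 2 ^ n : ℤ)) (M * 2 ^ n)).image fun k : ℤ => (k : ℝ) / 2 ^ n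

lemma quantize_mem_quantizedValues {M n : ℕ} {x : ℝ} (hx : x ∈ Set.Icc (-(M : ℝ)) M) :
    quantize n x ∈ quantizedValues M n := by
  refine Finset.mem_image.2 ⟨⌊(2 : ℝ) ^ n * x⌋, Finset.mem_Icc.2 ⟨?_, ?_⟩, rfl⟩
  · rw [Int.le_floor]
    push_cast
    nlinarith [hx.1, show (0 : ℝ) < 2 ^ n by positivity]
  · have h := Int.floor_le ((2 : ℝ) ^ n * x)
    have h2 : (2 : ℝ) ^ n * x ≤ M * 2 ^ n := by
      nlinarith [hx.2, show (0 : ℝ) < 2 ^ n by positivity]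
    exact_mod_cast h.trans h2

lemma card_quantizedValues_le (M n : ℕ) :
    ((quantizedValues M n).card : ℝ) ≤ (2 * M + 1) * 2 ^ n := by
  have h : (quantizedValues M n).card ≤ (2 * M + 1) * 2 ^ n := by
    refine Finset.card_image_le.trans ?_
    rw [Int.card_Icc]
    have := Nat.one_le_two_pow (n := n)
    have h2 : ((M : ℤ) * 2 ^ n + 1 - -(M * 2 ^ n)) = ((2 * (M * 2 ^ n) + 1 : ℕ) : ℤ) := by
      push_cast; ring
    rw [h2, Int.toNat_natCast]
    nlinarith
  exact_mod_cast h

/-- The entropy, in nats, of the partition of `[-M, M]` into the cells of the quantizer, for a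
not necessarily normalized measure. -/
noncomputable def cellEntropy (M n : ℕ) (ν : Measure ℝ) : ℝ :=
  ∑ x ∈ quantizedValues M n, Real.negMulLog (ν.real (quantize n ⁻¹' {x}))

lemma measurableSet_cell (n : ℕ) (x : ℝ) : MeasurableSet (quantize n ⁻¹' {x}) :=
  measurable_quantize n (measurableSet_singleton x)

lemma cellEntropy_nonneg (M n : ℕ) {μ : Measure ℝ} (h : μ Set.univ ≤ 1) : 0 ≤ cellEntropy M n μ := by
  refine Finset.sum_nonneg fun x _ => Real.negMulLog_nonneg measureReal_nonneg ?_
  exact ENNReal.toReal_le_of_le_ofReal zero_le_one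
    (by simpa using (measure_mono (Set.subset_univ _)).trans h)

lemma negMulLog_measureReal_cell_eq_zero (n : ℕ) {μ : Measure ℝ} {F : Finset ℝ} (hF : μ (F : Set ℝ)ᶜ = 0) {x : ℝ}
    (hx : x ∉ F.image (quantize n)) : Real.negMulLog (μ.real (quantize n ⁻¹' {x})) = 0 := by
  have : μ (quantize n ⁻¹' {x}) = 0 := by
    refine measure_mono_null ?_ hF
    rintro y rfl hy
    exact hx (Finset.mem_image_of_mem _ (by simpa using hy))
  simp [measureReal_def, this]

/-- Only cells containing a point of `F` are charged, and each costs at most one nat, whatever `n`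
is. -/
lemma cellEntropy_le_card (M n : ℕ) {μ : Measure ℝ} {F : Finset ℝ} (hF : μ (F : Set ℝ)ᶜ = 0) :
    cellEntropy M n μ ≤ F.card := by
  have h : cellEntropy M n μ
      ≤ ∑ x ∈ quantizedValues M n, if x ∈ F.image (quantize n) then (1 : ℝ) else 0 := by
    refine Finset.sum_le_sum fun x _ => ?_
    split_ifs with hx
    · exact negMulLog_le_one measureReal_nonneg
    · exact (negMulLog_measureReal_cell_eq_zero n hF hx).le
  refine h.trans ?_
  rw [← Finset.sum_filter, Finset.sum_const, nsmul_eq_mul, mul_one]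
  refine Nat.cast_le.2 ((Finset.card_le_card (t := F.image (quantize n)) ?_).trans
    Finset.card_image_le)
  intro x hx
  exact (Finset.mem_filter.1 hx).2

section

variable (M n : ℕ) (μ ν : Measure ℝ) [IsFiniteMeasure μ] [IsFiniteMeasure ν]

lemma sum_measureReal_cell_le :
    ∑ x ∈ quantizedValues M n, μ.real (quantize n ⁻¹' {x}) ≤ μ.real Set.univ := by
  rw [sum_measureReal_preimage_singleton _ fun x _ => measurableSet_cell n x]
  exact measureReal_mono (Set.subset_univ _)

lemma sum_measureReal_cell (h : μ (Set.Icc (-(M : ℝ)) M)ᶜ = 0) :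
    ∑ x ∈ quantizedValues M n, μ.real (quantize n ⁻¹' {x}) = μ.real Set.univ := by
  rw [sum_measureReal_preimage_singleton _ fun x _ => measurableSet_cell n x]
  refine measureReal_congr ?_
  filter_upwards [compl_mem_ae_iff.2 h] with x hx
  have hx' : x ∈ Set.Icc (-(M : ℝ)) M := by simpa using hx
  have := quantize_mem_quantizedValues (n := n) hx'
  exact propext ⟨fun _ => trivial, fun _ => this⟩

lemma cellEntropy_add_le :
    cellEntropy M n (μ + ν) ≤ cellEntropy M n μ + cellEntropy M n ν := by
  simp only [cellEntropy, ← Finset.sum_add_distrib]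
  refine Finset.sum_le_sum fun x _ => ?_
  rw [measureReal_add_apply]
  exact negMulLog_add_le measureReal_nonneg measureReal_nonneg

lemma le_cellEntropy_add :
    cellEntropy M n μ + cellEntropy M n ν
      ≤ cellEntropy M n (μ + ν) + (μ + ν).real Set.univ * Real.log 2 := by
  have h : cellEntropy M n μ + cellEntropy M n ν ≤ cellEntropy M n (μ + ν) +
      (∑ x ∈ quantizedValues M n, (μ + ν).real (quantize n ⁻¹' {x})) * Real.log 2 := by
    simp only [cellEntropy, ← Finset.sum_add_distrib, Finset.sum_mul]
    refine Finset.sum_le_sum fun x _ => ?_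
    rw [measureReal_add_apply]
    exact le_negMulLog_add measureReal_nonneg measureReal_nonneg
  refine h.trans ?_
  exact add_le_add le_rfl (mul_le_mul_of_nonneg_right (sum_measureReal_cell_le M n (μ + ν))
    (Real.log_nonneg (by norm_num)))

lemma cellEntropy_le :
    cellEntropy M n μ ≤ 1 + μ.real Set.univ * (Real.log (2 * M + 1) + n * Real.log 2) := by
  have hN : (0 : ℝ) < (2 * M + 1) * 2 ^ n := by positivity
  have hlog : Real.log ((2 * M + 1) * 2 ^ n) = Real.log (2 * M + 1) + n * Real.log 2 := by
    rw [Real.log_mul (by positivity) (by positivity), Real.log_pow]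
  have h : cellEntropy M n μ ≤ ∑ x ∈ quantizedValues M n, (((2 * M + 1) * 2 ^ n : ℝ)⁻¹ +
      μ.real (quantize n ⁻¹' {x}) * Real.log ((2 * M + 1) * 2 ^ n)) :=
    Finset.sum_le_sum fun x _ => negMulLog_le_inv_add measureReal_nonneg hN
  rw [Finset.sum_add_distrib, Finset.sum_const, ← Finset.sum_mul, nsmul_eq_mul] at h
  refine h.trans (add_le_add ?_ ?_)
  · rw [← div_eq_mul_inv, div_le_one hN]
    exact card_quantizedValues_le M n
  · rw [hlog]
    refine mul_le_mul_of_nonneg_right (sum_measureReal_cell_le M n μ) ?_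
    have := Real.log_nonneg (show (1 : ℝ) ≤ 2 * M + 1 by linarith [(Nat.cast_nonneg M : (0:ℝ) ≤ M)])
    have := Real.log_nonneg (show (1 : ℝ) ≤ 2 by norm_num)
    positivity

/-- A charged cell has mass `p ≤ L * 2⁻ⁿ`, hence `-log p ≥ n log 2 - log L`. -/
lemma le_cellEntropy_of_le_volume {L : ℕ} (hL : 1 ≤ L) (hμ : ∀ s, μ s ≤ L * volume s)
    (h : μ (Set.Icc (-(M : ℝ)) M)ᶜ = 0) :
    μ.real Set.univ * (n * Real.log 2 - Real.log L) ≤ cellEntropy M n μ := by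
  rw [← sum_measureReal_cell M n μ h, Finset.sum_mul]
  refine Finset.sum_le_sum fun x _ => ?_
  rcases (measureReal_nonneg (μ := μ) (s := quantize n ⁻¹' {x})).eq_or_lt with h0 | h0
  · simp [← h0]
  have hp : μ.real (quantize n ⁻¹' {x}) ≤ L * (2 ^ n)⁻¹ := by
    refine ENNReal.toReal_le_of_le_ofReal (by positivity) ((hμ _).trans ?_)
    rw [ENNReal.ofReal_mul (by positivity), ENNReal.ofReal_natCast]
    gcongr
    exact volume_quantize_preimage_le n x
  have hlog := Real.log_le_log h0 hp
  have hL' : (0 : ℝ) < L := by exact_mod_cast hL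
  rw [Real.log_mul hL'.ne' (by positivity), Real.log_inv, Real.log_pow] at hlog
  rw [Real.negMulLog]
  nlinarith

end

/-! ### Truncation of both components, and the linear growth rate. -/

lemma exists_restrict_le_volume (a : Measure ℝ) [IsFiniteMeasure a] (ha : a ≪ volume)
    {ε : ℝ} (hε : 0 < ε) :
    ∃ E : Set ℝ, MeasurableSet E ∧ ∃ L : ℕ, 1 ≤ L ∧ (∀ s, a.restrict E s ≤ L * volume s) ∧
      a.real Eᶜ ≤ ε := by
  set E : ℕ → Set ℝ := fun L => {x | a.rnDeriv volume x ≤ L}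
  have hE : ∀ L, MeasurableSet (E L) := fun L =>
    measurableSet_le (Measure.measurable_rnDeriv _ _) measurable_const
  have hbound : ∀ L s, a.restrict (E L) s ≤ L * volume s := by
    intro L
    refine Measure.le_iff'.1 (show a.restrict (E L) ≤ (L : ℝ≥0∞) • volume from Measure.le_iff.2 fun s hs => ?_)
    rw [Measure.restrict_apply hs, ← Measure.setLIntegral_rnDeriv ha]
    calc ∫⁻ x in s ∩ E L, a.rnDeriv volume x
        ≤ ∫⁻ x in s ∩ E L, (L : ℝ≥0∞) := setLIntegral_mono' (hs.inter (hE L)) fun x hx => hx.2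
      _ = L * volume (s ∩ E L) := setLIntegral_const _ _
      _ ≤ L * volume s := by gcongr; exact Set.inter_subset_left
  have hlim : Tendsto (fun L => a (E L)ᶜ) atTop (𝓝 (a (⋂ L, (E L)ᶜ))) := by
    refine tendsto_measure_iInter_atTop (fun L => (hE L).compl.nullMeasurableSet) ?_
      ⟨0, measure_ne_top _ _⟩
    intro L L' h x hx hx'
    exact hx (le_trans (show a.rnDeriv volume x ≤ L from hx') (by exact_mod_cast h))
  have h0 : a (⋂ L, (E L)ᶜ) = 0 := by
    have : ∀ᵐ x ∂a, a.rnDeriv volume x < ⊤ := ha.ae_le (Measure.rnDeriv_lt_top a volume)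
    refine measure_mono_null ?_ this
    intro x hx hlt
    obtain ⟨L, hL⟩ := ENNReal.exists_nat_gt hlt.ne
    exact Set.mem_iInter.1 hx L hL.le
  rw [h0] at hlim
  obtain ⟨L, hL, hL1⟩ := ((hlim.eventually (gt_mem_nhds (ENNReal.ofReal_pos.2 hε))).and
    (eventually_ge_atTop 1)).exists
  exact ⟨E L, hE L, L, hL1, hbound L, ENNReal.toReal_le_of_le_ofReal hε.le hL.le⟩

lemma IsDiscrete.exists_finset {s : Measure ℝ} [IsFiniteMeasure s] (hs : IsDiscrete s)
    {ε : ℝ} (hε : 0 < ε) : ∃ F : Finset ℝ, s.real (F : Set ℝ)ᶜ ≤ ε := by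
  obtain ⟨S, hS, hS0⟩ := hs
  -- The point `0` only makes the set nonempty, so that it can be enumerated.
  obtain ⟨f, hf⟩ := (hS.insert 0).exists_eq_range (Set.insert_nonempty 0 S)
  have hlim : Tendsto (fun n => s ((Finset.range n).image f : Set ℝ)ᶜ) atTop
      (𝓝 (s (⋂ n, ((Finset.range n).image f : Set ℝ)ᶜ))) := by
    refine tendsto_measure_iInter_atTop
      (fun n => (Finset.measurableSet _).compl.nullMeasurableSet) ?_ ⟨0, measure_ne_top _ _⟩
    intro m n h
    exact Set.compl_subset_compl.2 (Finset.coe_subset.2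
      (Finset.image_subset_image (Finset.range_mono h)))
  have h0 : s (⋂ n, ((Finset.range n).image f : Set ℝ)ᶜ) = 0 := by
    refine measure_mono_null ?_ hS0
    intro x hx hxS
    obtain ⟨k, rfl⟩ : x ∈ Set.range f := hf ▸ Set.mem_insert_of_mem 0 hxS
    exact Set.mem_iInter.1 hx (k + 1)
      (Finset.mem_coe.2 (Finset.mem_image_of_mem f (Finset.self_mem_range_succ k)))
  rw [h0] at hlim
  obtain ⟨n, hn⟩ := (hlim.eventually (gt_mem_nhds (ENNReal.ofReal_pos.2 hε))).exists
  exact ⟨_, ENNReal.toReal_le_of_le_ofReal hε.le hn.le⟩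

section

variable {μ a s : Measure ℝ} [IsFiniteMeasure a] [IsFiniteMeasure s] {M : ℕ}

/-- The tail of `s` outside a finite set is lumped with `a`; its mass `ε` adds only `ε` to the
slope. -/
lemma exists_cellEntropy_add_le (hs : IsDiscrete s) {ε : ℝ} (hε : 0 < ε) :
    ∃ C : ℝ, ∀ n, cellEntropy M n (a + s) ≤ (a.real Set.univ + ε) * (n * Real.log 2) + C := by
  obtain ⟨F, hF⟩ := hs.exists_finset hε
  refine ⟨1 + (a.real Set.univ + ε) * Real.log (2 * M + 1) + F.card, fun n => ?_⟩
  have hsplit : a + s = (a + s.restrict (F : Set ℝ)ᶜ) + s.restrict F := by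
    rw [add_assoc, add_comm (s.restrict _), Measure.restrict_add_restrict_compl F.measurableSet]
  rw [hsplit]
  have h1 := cellEntropy_add_le M n (a + s.restrict (F : Set ℝ)ᶜ) (s.restrict F)
  have h2 := cellEntropy_le M n (a + s.restrict (F : Set ℝ)ᶜ)
  have h3 := cellEntropy_le_card M n (μ := s.restrict F) (F := F)
    (by rw [Measure.restrict_apply F.measurableSet.compl]; simp)
  have h4 : (a + s.restrict (F : Set ℝ)ᶜ).real Set.univ ≤ a.real Set.univ + ε := by
    rw [measureReal_add_apply]
    simpa [measureReal_restrict_apply] using hF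
  have h5 := Real.log_nonneg (show (1 : ℝ) ≤ 2 * M + 1 by
    linarith [(Nat.cast_nonneg M : (0 : ℝ) ≤ M)])
  have h6 := Real.log_nonneg (show (1 : ℝ) ≤ 2 by norm_num)
  have h7 := mul_le_mul_of_nonneg_right h4
    (show 0 ≤ Real.log (2 * M + 1) + n * Real.log 2 by positivity)
  linarith

/-- Everything but the bounded-density part of `a` is discarded; by near-superadditivity this costs
at most `log 2`. -/
lemma exists_le_cellEntropy_add (ha : a ≪ volume) (hmass : (a + s) Set.univ ≤ 1)
    (hM : (a + s) (Set.Icc (-(M : ℝ)) M)ᶜ = 0) {ε : ℝ} (hε : 0 < ε) :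
    ∃ C : ℝ, ∀ n, (a.real Set.univ - ε) * (n * Real.log 2) - C ≤ cellEntropy M n (a + s) := by
  obtain ⟨E, hE, L, hL, hbound, hEε⟩ := exists_restrict_le_volume a ha hε
  refine ⟨a.real E * Real.log L + Real.log 2, fun n => ?_⟩
  have hsplit : a + s = a.restrict E + (a.restrict Eᶜ + s) := by
    rw [← add_assoc, Measure.restrict_add_restrict_compl hE]
  have h1 := le_cellEntropy_add M n (a.restrict E) (a.restrict Eᶜ + s)
  rw [← hsplit] at h1
  have h2 : 0 ≤ cellEntropy M n (a.restrict Eᶜ + s) := by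
    refine cellEntropy_nonneg M n (le_trans ?_ hmass)
    rw [hsplit]
    exact Measure.le_add_left le_rfl _
  have h3 := le_cellEntropy_of_le_volume M n (a.restrict E) hL hbound
    (le_antisymm ((Measure.restrict_apply_le _ _).trans (hM ▸ Measure.le_add_right le_rfl _)) bot_le)
  have h4 : (a + s).real Set.univ ≤ 1 :=
    ENNReal.toReal_le_of_le_ofReal zero_le_one (by simpa using hmass)
  have h5 : a.real E + a.real Eᶜ = a.real Set.univ := measureReal_add_measureReal_compl hE
  have h6 := Real.log_nonneg (show (1 : ℝ) ≤ 2 by norm_num)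
  have h7 : (a.restrict E).real Set.univ = a.real E := by simp [measureReal_restrict_apply]
  rw [h7] at h3
  have h8 : (a.real Set.univ - ε) * (n * Real.log 2) ≤ a.real E * (n * Real.log 2) :=
    mul_le_mul_of_nonneg_right (by linarith) (by positivity)
  have h9 := mul_le_mul_of_nonneg_right h4 h6
  linarith

lemma tendsto_cellEntropy_div (ha : a ≪ volume) (hs : IsDiscrete s)
    (hmass : (a + s) Set.univ ≤ 1) (hM : (a + s) (Set.Icc (-(M : ℝ)) M)ᶜ = 0) :
    Tendsto (fun n : ℕ => cellEntropy M n (a + s) / Real.log 2 / n) atTop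
      (𝓝 (a.real Set.univ)) := by
  have hl : 0 < Real.log 2 := Real.log_pos (by norm_num)
  rw [Metric.tendsto_atTop']
  intro ε hε
  obtain ⟨C₁, h₁⟩ := exists_cellEntropy_add_le (a := a) (M := M) hs (half_pos hε)
  obtain ⟨C₂, h₂⟩ := exists_le_cellEntropy_add ha hmass hM (half_pos hε)
  obtain ⟨N, hN⟩ := exists_nat_gt (max C₁ C₂ / (ε / 2 * Real.log 2))
  refine ⟨N, fun n hn => ?_⟩
  have hn0 : (0 : ℝ) < n := by exact_mod_cast (Nat.zero_le N).trans_lt hn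
  have hn' : max C₁ C₂ < n * (ε / 2 * Real.log 2) := by
    rw [← div_lt_iff₀ (by positivity)]
    exact hN.trans (by exact_mod_cast hn)
  have h1 := h₁ n
  have h2 := h₂ n
  have := le_max_left C₁ C₂
  have := le_max_right C₁ C₂
  rw [Real.dist_eq, abs_lt, div_div]
  constructor
  · rw [lt_sub_iff_add_lt, lt_div_iff₀ (by positivity)]
    linarith
  · rw [sub_lt_iff_lt_add, div_lt_iff₀ (by positivity)]
    linarith

end

/-! ### Entropy of quantized laws. -/

lemma isDiscrete_map_quantize {μ : Measure ℝ} {M : ℕ} (hM : μ (Set.Icc (-(M : ℝ)) M)ᶜ = 0)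
    (n : ℕ) : IsDiscrete (μ.map (quantize n)) := by
  refine ⟨quantizedValues M n, (quantizedValues M n).countable_toSet, ?_⟩
  rw [Measure.map_apply (measurable_quantize n) (quantizedValues M n).measurableSet.compl]
  refine measure_mono_null ?_ hM
  intro x hx hx'
  exact hx (quantize_mem_quantizedValues hx')

lemma entropy_map_quantize {μ : Measure ℝ} {M : ℕ} (hmass : μ Set.univ ≤ 1)
    (hM : μ (Set.Icc (-(M : ℝ)) M)ᶜ = 0) (n : ℕ) :
    entropy (μ.map (quantize n)) = ENNReal.ofReal (cellEntropy M n μ / Real.log 2) := by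
  have hl : 0 < Real.log 2 := Real.log_pos (by norm_num)
  have hcell : ∀ x, (μ.map (quantize n)).real {x} = μ.real (quantize n ⁻¹' {x}) := fun x =>
    map_measureReal_apply (measurable_quantize n) (measurableSet_singleton x)
  rw [entropy, if_pos (isDiscrete_map_quantize hM n), tsum_eq_sum (s := quantizedValues M n),
    ← ENNReal.ofReal_sum_of_nonneg, cellEntropy, Finset.sum_div]
  · simp only [hcell]
  · intro x _
    rw [hcell]
    refine div_nonneg (Real.negMulLog_nonneg measureReal_nonneg ?_) hl.le
    exact ENNReal.toReal_le_of_le_ofReal zero_le_one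
      (by simpa using (measure_mono (Set.subset_univ _)).trans hmass)
  · intro x hx
    rw [hcell]
    have : μ (quantize n ⁻¹' {x}) = 0 := by
      refine measure_mono_null ?_ hM
      rintro y rfl hy
      exact hx (quantize_mem_quantizedValues hy)
    simp [measureReal_def, this]

lemma tendsto_entropy_map_quantize_div {a s : Measure ℝ} {M : ℕ} (ha : a ≪ volume)
    (hs : IsDiscrete s) (hmass : (a + s) Set.univ ≤ 1)
    (hM : (a + s) (Set.Icc (-(M : ℝ)) M)ᶜ = 0) :
    Tendsto (fun n : ℕ => entropy ((a + s).map (quantize n)) / n) atTop (𝓝 (a Set.univ)) := by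
  have hfa : IsFiniteMeasure a :=
    ⟨((Measure.le_add_right le_rfl _).trans hmass).trans_lt ENNReal.one_lt_top⟩
  have hfs : IsFiniteMeasure s :=
    ⟨((Measure.le_add_left le_rfl _).trans hmass).trans_lt ENNReal.one_lt_top⟩
  have h := ENNReal.tendsto_ofReal (tendsto_cellEntropy_div ha hs hmass hM)
  rw [ofReal_measureReal] at h
  refine h.congr' ?_
  filter_upwards [eventually_gt_atTop 0] with n hn
  rw [entropy_map_quantize hmass hM, ENNReal.ofReal_div_of_pos (by exact_mod_cast hn),
    ENNReal.ofReal_natCast]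

/-- A law on finitely many points has bounded entropy after quantization. -/
lemma entropy_map_quantize_le_card {μ : Measure ℝ} (hmass : μ Set.univ ≤ 1) (F : Finset ℝ)
    (hF : μ (F : Set ℝ)ᶜ = 0) (n : ℕ) :
    entropy (μ.map (quantize n)) ≤ ENNReal.ofReal (F.card / Real.log 2) := by
  have : IsFiniteMeasure μ := ⟨hmass.trans_lt ENNReal.one_lt_top⟩
  have hl : 0 < Real.log 2 := Real.log_pos (by norm_num)
  obtain ⟨M, hM⟩ : ∃ M : ℕ, (F : Set ℝ) ⊆ Set.Icc (-(M : ℝ)) M := by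
    obtain ⟨r, hr⟩ := F.finite_toSet.isBounded.subset_closedBall 0
    obtain ⟨M, hM⟩ := exists_nat_ge r
    refine ⟨M, fun x hx => ?_⟩
    have := hr hx
    rw [Real.closedBall_eq_Icc] at this
    exact ⟨by linarith [this.1], by linarith [this.2]⟩
  rw [entropy_map_quantize hmass (measure_mono_null (Set.compl_subset_compl.2 hM) hF)]
  exact ENNReal.ofReal_le_ofReal
    (div_le_div_of_nonneg_right (cellEntropy_le_card M n hF) hl.le)

lemma IsDiscrete.of_absolutelyContinuous {α : Type*} [MeasurableSpace α] {μ ν : Measure α}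
    (hν : IsDiscrete ν) (h : μ ≪ ν) : IsDiscrete μ :=
  hν.imp fun _ hS => ⟨hS.1, h hS.2⟩

/-! ### Conditional laws of `X` given `g (X)`. -/

section

variable {Ω : Type*} [MeasurableSpace Ω] {P : Measure Ω} [IsFiniteMeasure P]

lemma condEntropy_congr_right {Z Y Y' : Ω → ℝ} (h : Y =ᵐ[P] Y') :
    condEntropy P Z Y = condEntropy P Z Y' := by
  rw [condEntropy, condEntropy, condDistrib_congr_right h, Measure.map_congr h]

lemma condEntropy_comp {X Y : Ω → ℝ} {f : ℝ → ℝ} (hX : Measurable X) (hf : Measurable f) :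
    condEntropy P (fun ω => f (X ω)) Y
      = ∫⁻ y, entropy ((condDistrib X Y P y).map f) ∂(P.map Y) := by
  refine lintegral_congr_ae ?_
  filter_upwards [condDistrib_comp Y hX.aemeasurable hf] with y hy
  rw [← Kernel.map_apply _ hf, ← hy]
  rfl

lemma condDistrib_comp_self_apply {X : Ω → ℝ} (hX : Measurable X) {g : ℝ → ℝ} (hg : Measurable g)
    {y : ℝ} (hy : P.map (fun ω => g (X ω)) {y} ≠ 0) :
    condDistrib X (fun ω => g (X ω)) P y
      = (P.map (fun ω => g (X ω)) {y})⁻¹ • (P.map X).restrict (g ⁻¹' {y}) := by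
  ext s hs
  rw [condDistrib_apply_of_ne_zero hX y hy, Measure.smul_apply, smul_eq_mul,
    Measure.restrict_apply hs, Measure.map_apply (by fun_prop) ((measurableSet_singleton y).prod hs),
    Measure.map_apply hX (hs.inter (hg (measurableSet_singleton y)))]
  congr 2
  ext ω
  simp [and_comm]

lemma ae_condDistrib_comp_self {X : Ω → ℝ} (hX : Measurable X) {g : ℝ → ℝ} (hg : Measurable g)
    {s : Set ℝ} (hs : MeasurableSet s) (hXs : ∀ᵐ ω ∂P, X ω ∈ s) :
    ∀ᵐ y ∂(P.map fun ω => g (X ω)),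
      ∀ᵐ x ∂(condDistrib X (fun ω => g (X ω)) P y), x ∈ s ∧ g x = y := by
  -- The joint law of `(g (X), X)` is carried by the transposed graph of `g` over `s`.
  refine Measure.ae_ae_of_ae_compProd (p := fun z : ℝ × ℝ => z.2 ∈ s ∧ g z.2 = z.1) ?_
  rw [compProd_map_condDistrib hX.aemeasurable, ae_map_iff (by fun_prop)]
  · filter_upwards [hXs] with ω hω using ⟨hω, rfl⟩
  · exact (measurable_snd hs).inter
      (measurableSet_eq_fun (hg.comp measurable_snd) measurable_fst)

end

lemma tendsto_entropy_condDistrib_mul_div {Ω : Type*} [MeasurableSpace Ω] {P : Measure Ω}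
    [IsProbabilityMeasure P] {X : Ω → ℝ} (hX : Measurable X) {a d : Measure ℝ}
    (hdecomp : P.map X = a + d) (ha : a ≪ volume) (hd : IsDiscrete d) {M : ℕ}
    (hM : P.map X (Set.Icc (-(M : ℝ)) M)ᶜ = 0) {g : ℝ → ℝ} (hg : Measurable g) (y : ℝ) :
    Tendsto (fun n : ℕ => entropy ((condDistrib X (fun ω => g (X ω)) P y).map (quantize n)) *
      P.map (fun ω => g (X ω)) {y} / n) atTop (𝓝 (a (g ⁻¹' {y}))) := by
  have hgy := hg (measurableSet_singleton y)
  have hPY : P.map (fun ω => g (X ω)) {y} = P.map X (g ⁻¹' {y}) := by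
    rw [← Measure.map_apply hg (measurableSet_singleton y), Measure.map_map hg hX]
    rfl
  by_cases hy : P.map (fun ω => g (X ω)) {y} = 0
  · have h0 : a (g ⁻¹' {y}) = 0 := by
      rw [hPY, hdecomp, Measure.add_apply, add_eq_zero] at hy
      exact hy.1
    simp [hy, h0]
  have hprob : IsProbabilityMeasure (condDistrib X (fun ω => g (X ω)) P y) := inferInstance
  have hκ := condDistrib_comp_self_apply hX hg hy
  set c := P.map (fun ω => g (X ω)) {y} with hc
  have hc' : c ≠ ⊤ := measure_ne_top _ _
  rw [hκ] at hprob ⊢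
  have hκM : (c⁻¹ • (P.map X).restrict (g ⁻¹' {y})) (Set.Icc (-(M : ℝ)) M)ᶜ = 0 := by
    rw [Measure.smul_apply, Measure.absolutelyContinuous_of_le Measure.restrict_le_self hM,
      smul_zero]
  rw [hdecomp, Measure.restrict_add, smul_add] at hprob hκM ⊢
  have h := tendsto_entropy_map_quantize_div
    ((Measure.absolutelyContinuous_restrict.trans ha).smul_left c⁻¹)
    (hd.of_absolutelyContinuous (Measure.absolutelyContinuous_restrict.smul_left c⁻¹))
    prob_le_one hκM
  have h2 := ENNReal.Tendsto.mul_const h (Or.inr hc')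
  -- The weight of the atom undoes the normalization of the conditional law.
  have hlim : (c⁻¹ • a.restrict (g ⁻¹' {y})) Set.univ * c = a (g ⁻¹' {y}) := by
    rw [Measure.smul_apply, Measure.restrict_apply_univ, smul_eq_mul, mul_right_comm,
      ENNReal.inv_mul_cancel hy hc', one_mul]
  rw [hlim] at h2
  refine h2.congr fun n => ?_
  simp only [div_eq_mul_inv, mul_right_comm]

/-! ### Fibres of `g` and the growth of the conditional entropy. -/

section

variable {ι : Type*} [Finite ι] {piece : ι → Set ℝ} {g : ℝ → ℝ}

lemma exists_finset_isConstOn_values (piece : ι → Set ℝ) (g : ℝ → ℝ) :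
    ∃ C : Finset ℝ, ∀ i, IsConstOn g (piece i) → ∃ c ∈ C, ∀ x ∈ piece i, g x = c := by
  classical
  have := Fintype.ofFinite ι
  refine ⟨Finset.univ.image fun i => if h : IsConstOn g (piece i) then h.choose else 0,
    fun i hi => ⟨hi.choose, Finset.mem_image.2 ⟨i, Finset.mem_univ i, dif_pos hi⟩,
      hi.choose_spec⟩⟩

/-- Away from the values `g` takes on the pieces where it is constant, the fibres of `g` have at
most one point in each piece. -/
lemma exists_finset_fibre (hg : ∀ i, Set.InjOn g (piece i) ∨ IsConstOn g (piece i))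
    (y : ℝ) :
    ∃ F : Finset ℝ, F.card ≤ Nat.card ι ∧
      ∀ i, ¬ IsConstOn g (piece i) ∨ y ∉ g '' piece i → ∀ x ∈ piece i, g x = y → x ∈ F := by
  classical
  have := Fintype.ofFinite ι
  -- A spurious `0` is harmless: `F` only has to cover the fibre.
  refine ⟨Finset.univ.image fun i => if h : (piece i ∩ g ⁻¹' {y}).Nonempty then h.choose else 0,
    ?_, fun i hi x hx hxy => ?_⟩
  · rw [Nat.card_eq_fintype_card]
    exact Finset.card_image_le
  · have h : (piece i ∩ g ⁻¹' {y}).Nonempty := ⟨x, hx, hxy⟩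
    refine Finset.mem_image.2 ⟨i, Finset.mem_univ i, ?_⟩
    rw [dif_pos h]
    rcases hi with hi | hi
    · exact ((hg i).resolve_right hi) h.choose_spec.1 hx
        (by rw [hxy]; exact h.choose_spec.2)
    · exact absurd ⟨x, hx, hxy⟩ hi

lemma measure_preimage_isConstOn_values {a : Measure ℝ} (ha : a ≪ volume)
    (ha0 : a (⋃ i, piece i)ᶜ = 0)
    (hg : ∀ i, Set.InjOn g (piece i) ∨ IsConstOn g (piece i)) {C : Finset ℝ}
    (hC : ∀ i, IsConstOn g (piece i) → ∃ c ∈ C, ∀ x ∈ piece i, g x = c) :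
    a (g ⁻¹' C) = a (⋃ i ∈ {i | IsConstOn g (piece i)}, piece i) := by
  refine le_antisymm ?_ (measure_mono ?_)
  · choose F _ hF using exists_finset_fibre hg
    have hsub : g ⁻¹' C ⊆ ((⋃ i ∈ {i | IsConstOn g (piece i)}, piece i) ∪ (⋃ i, piece i)ᶜ) ∪
        ⋃ y ∈ C, (F y : Set ℝ) := by
      intro x hx
      by_cases hx' : x ∈ ⋃ i, piece i
      · obtain ⟨i, hi⟩ := Set.mem_iUnion.1 hx'
        by_cases hci : IsConstOn g (piece i)
        · exact Or.inl (Or.inl (Set.mem_biUnion hci hi))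
        · exact Or.inr (Set.mem_biUnion (show g x ∈ (C : Set ℝ) from hx)
            (hF (g x) i (Or.inl hci) x hi rfl))
      · exact Or.inl (Or.inr hx')
    have h0 : a (⋃ y ∈ C, (F y : Set ℝ)) = 0 :=
      ha ((C.countable_toSet.biUnion fun y _ => (F y).countable_toSet).measure_zero volume)
    refine (measure_mono hsub).trans ((measure_union_le _ _).trans ?_)
    rw [h0, add_zero]
    refine (measure_union_le _ _).trans ?_
    rw [ha0, add_zero]
  · intro x hx
    obtain ⟨i, hi, hxi⟩ := Set.mem_iUnion₂.1 hx
    obtain ⟨c, hc, h⟩ := hC i hi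
    exact Set.mem_preimage.2 ((h x hxi).symm ▸ hc)

variable {Ω : Type*} [MeasurableSpace Ω] {P : Measure Ω} [IsProbabilityMeasure P]
  {X : Ω → ℝ} {a d : Measure ℝ}

lemma exists_setLIntegral_entropy_condDistrib_le (hX : Measurable X)
    (hpiece : ∀ i, MeasurableSet (piece i)) (hXp : ∀ᵐ ω ∂P, X ω ∈ ⋃ i, piece i)
    (hgm : Measurable g) (hg : ∀ i, Set.InjOn g (piece i) ∨ IsConstOn g (piece i)) {C : Finset ℝ}
    (hC : ∀ i, IsConstOn g (piece i) → ∃ c ∈ C, ∀ x ∈ piece i, g x = c) (n : ℕ) :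
    ∫⁻ y in (C : Set ℝ)ᶜ, entropy ((condDistrib X (fun ω => g (X ω)) P y).map (quantize n))
      ∂(P.map fun ω => g (X ω)) ≤ ENNReal.ofReal (Nat.card ι / Real.log 2) := by
  have hprob : IsProbabilityMeasure (P.map fun ω => g (X ω)) :=
    Measure.isProbabilityMeasure_map (by fun_prop)
  have hae := ae_condDistrib_comp_self hX hgm (MeasurableSet.iUnion hpiece) hXp
  calc _ ≤ ∫⁻ y in (C : Set ℝ)ᶜ, ENNReal.ofReal (Nat.card ι / Real.log 2)
        ∂(P.map fun ω => g (X ω)) := by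
        refine lintegral_mono_ae ?_
        filter_upwards [ae_restrict_of_ae hae, ae_restrict_mem C.measurableSet.compl] with y hy hyC
        obtain ⟨F, hcard, hF⟩ := exists_finset_fibre hg y
        refine (entropy_map_quantize_le_card prob_le_one F ?_ n).trans
          (ENNReal.ofReal_le_ofReal (div_le_div_of_nonneg_right (by exact_mod_cast hcard)
            (Real.log_nonneg (by norm_num))))
        rw [← mem_ae_iff]
        filter_upwards [hy] with x hx
        obtain ⟨i, hi⟩ := Set.mem_iUnion.1 hx.1
        refine hF i ?_ x hi hx.2
        by_cases hci : IsConstOn g (piece i)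
        · right
          rintro ⟨x', hx', hxy'⟩
          obtain ⟨c, hc, h⟩ := hC i hci
          exact hyC (hxy' ▸ (h x' hx').symm ▸ hc)
        · exact Or.inl hci
    _ ≤ ENNReal.ofReal (Nat.card ι / Real.log 2) := by
        rw [setLIntegral_const]
        exact mul_le_of_le_one_right' prob_le_one

lemma tendsto_condEntropy_div (hX : Measurable X) (hdecomp : P.map X = a + d) (ha : a ≪ volume)
    (hd : IsDiscrete d) (hpiece : ∀ i, IsCompact (piece i)) (hXp : ∀ᵐ ω ∂P, X ω ∈ ⋃ i, piece i)
    {M : ℕ} (hM : P.map X (Set.Icc (-(M : ℝ)) M)ᶜ = 0) (ha0 : a (⋃ i, piece i)ᶜ = 0)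
    (hgm : Measurable g) (hg : ∀ i, Set.InjOn g (piece i) ∨ IsConstOn g (piece i)) :
    Tendsto (fun n : ℕ => condEntropy P (fun ω => quantize n (X ω)) (fun ω => g (X ω)) / n) atTop
      (𝓝 (a (⋃ i ∈ {i | IsConstOn g (piece i)}, piece i))) := by
  obtain ⟨C, hC⟩ := exists_finset_isConstOn_values piece g
  have hmain := tendsto_finsetSum C fun y _ =>
    tendsto_entropy_condDistrib_mul_div hX hdecomp ha hd hM hgm y
  rw [sum_measure_preimage_singleton C fun y _ => hgm (measurableSet_singleton y),
    measure_preimage_isConstOn_values ha ha0 hg hC] at hmain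
  have hrest : Tendsto (fun n : ℕ => (∫⁻ y in (C : Set ℝ)ᶜ,
      entropy ((condDistrib X (fun ω => g (X ω)) P y).map (quantize n))
        ∂(P.map fun ω => g (X ω))) / n) atTop (𝓝 0) := by
    have hK := ENNReal.Tendsto.const_div ENNReal.tendsto_nat_nhds_top
      (Or.inr (ENNReal.ofReal_ne_top (r := Nat.card ι / Real.log 2)))
    rw [ENNReal.div_top] at hK
    refine tendsto_of_tendsto_of_tendsto_of_le_of_le tendsto_const_nhds hK (fun _ => zero_le)
      fun n => ENNReal.div_le_div_right (exists_setLIntegral_entropy_condDistrib_le hX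
        (fun i => (hpiece i).measurableSet) hXp hgm hg hC n) _
  have h := hmain.add hrest
  rw [add_zero] at h
  refine h.congr fun n => ?_
  rw [condEntropy_comp hX (measurable_quantize n),
    ← lintegral_add_compl (μ := P.map fun ω => g (X ω))
      (fun y => entropy ((condDistrib X (fun ω => g (X ω)) P y).map (quantize n))) C.measurableSet,
    lintegral_finset, ENNReal.add_div]
  simp only [div_eq_mul_inv, Finset.sum_mul]

end

end InfoLoss

/-! ### The relative information loss. -/

theorem proposition13 {Ω : Type*} [MeasurableSpace Ω] (P : Measure Ω) [IsProbabilityMeasure P]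
    (X : Ω → ℝ) (hX : Measurable X)
    (Pac Pd : Measure ℝ) (hdecomp : P.map X = Pac + Pd)
    (hac : Pac ≪ volume) (hd : InfoLoss.IsDiscrete Pd)
    {ι : Type*} [Finite ι] (piece : ι → Set ℝ) (𝒳 : Set ℝ)
    (hdisj : Pairwise (fun i j => Disjoint (piece i) (piece j)))
    (hcover : ⋃ i, piece i = 𝒳)
    (hcompact : ∀ i, IsCompact (piece i))
    (hX𝒳 : ∀ᵐ ω ∂P, X ω ∈ 𝒳)
    (hpos : 0 < Pac 𝒳)
    (g : ℝ → ℝ) (hgmeas : Measurable (fun x : 𝒳 => g x))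
    (hgbdd : Bornology.IsBounded (g '' 𝒳))
    (hg : ∀ i, Set.InjOn g (piece i) ∨ InfoLoss.IsConstOn g (piece i)) :
    InfoLoss.HasRelInfoLoss P X (fun ω => g (X ω))
      (Pac (⋃ i ∈ {i | InfoLoss.IsConstOn g (piece i)}, piece i) / Pac 𝒳) := by
  have hcomp : IsCompact 𝒳 := hcover ▸ isCompact_iUnion hcompact
  have hmap0 : P.map X 𝒳ᶜ = 0 := by
    rw [Measure.map_apply hX hcomp.measurableSet.compl]
    exact hX𝒳
  have hprob : IsProbabilityMeasure (P.map X) := Measure.isProbabilityMeasure_map hX.aemeasurable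
  have hPac0 : Pac 𝒳ᶜ = 0 := by
    rw [hdecomp, Measure.add_apply, add_eq_zero] at hmap0
    exact hmap0.1
  have hPac : Pac Set.univ = Pac 𝒳 := by
    rw [← measure_add_measure_compl hcomp.measurableSet, hPac0, add_zero]
  obtain ⟨M, hM⟩ : ∃ M : ℕ, 𝒳 ⊆ Set.Icc (-(M : ℝ)) M := by
    obtain ⟨r, hr⟩ := hcomp.isBounded.subset_closedBall 0
    obtain ⟨M, hM⟩ := exists_nat_ge r
    refine ⟨M, hr.trans ?_⟩
    rw [Real.closedBall_eq_Icc]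
    exact Set.Icc_subset_Icc (by linarith) (by linarith)
  have hM0 : P.map X (Set.Icc (-(M : ℝ)) M)ᶜ = 0 :=
    measure_mono_null (Set.compl_subset_compl.2 hM) hmap0
  have hent : ∀ n, P.map (fun ω => InfoLoss.quantize n (X ω)) = (P.map X).map (InfoLoss.quantize n) :=
    fun n => (Measure.map_map (InfoLoss.measurable_quantize n) hX).symm
  have hH : Tendsto (fun n : ℕ => InfoLoss.entropy (P.map fun ω => InfoLoss.quantize n (X ω)) / n)
      atTop (𝓝 (Pac 𝒳)) := by
    simp only [hent]
    rw [hdecomp] at hprob hM0 ⊢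
    exact hPac ▸ InfoLoss.tendsto_entropy_map_quantize_div hac hd prob_le_one hM0
  have hfin : Pac 𝒳 ≠ ⊤ := by
    refine ((Measure.le_add_right le_rfl : Pac ≤ Pac + Pd) 𝒳).trans_lt ?_ |>.ne
    rw [← hdecomp]
    exact measure_lt_top _ _
  -- `g` is measurable only on `𝒳`; a Borel extension `G` changes `Y` on a null set only.
  obtain ⟨G, hGm, hG⟩ := (MeasurableEmbedding.subtype_coe hcomp.measurableSet).exists_measurable_extend
    hgmeas fun _ => ⟨0⟩
  have hGg : ∀ x ∈ 𝒳, G x = g x := fun x hx => congrFun hG ⟨x, hx⟩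
  have hGi : ∀ i, ∀ x ∈ piece i, G x = g x := fun i x hx =>
    hGg x (hcover ▸ Set.mem_iUnion_of_mem i hx)
  have hconst : ∀ i, InfoLoss.IsConstOn G (piece i) ↔ InfoLoss.IsConstOn g (piece i) := fun i =>
    exists_congr fun c => forall₂_congr fun x hx => by rw [hGi i x hx]
  have hGinj : ∀ i, Set.InjOn G (piece i) ∨ InfoLoss.IsConstOn G (piece i) := fun i =>
    (hg i).imp (fun h => h.congr fun x hx => (hGi i x hx).symm) (hconst i).2
  have hY : (fun ω => g (X ω)) =ᵐ[P] fun ω => G (X ω) := by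
    filter_upwards [hX𝒳] with ω hω using (hGg _ hω).symm
  have hcond := InfoLoss.tendsto_condEntropy_div hX hdecomp hac hd hcompact (by rwa [hcover]) hM0
    (by rwa [hcover]) hGm hGinj
  simp only [hconst, ← InfoLoss.condEntropy_congr_right hY] at hcond
  constructor
  -- Zero entropy would make the quotient by `n` vanish, but its limit `Pac 𝒳` is positive.
  · filter_upwards [hH.eventually (lt_mem_nhds hpos)] with n hn
    refine ⟨pos_iff_ne_zero.2 fun h => ?_, ?_⟩
    · simp [h] at hn
    · rw [hent, InfoLoss.entropy_map_quantize prob_le_one hM0]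
      exact ENNReal.ofReal_lt_top
  · refine (ENNReal.Tendsto.div hcond (Or.inr hpos.ne') hH (Or.inl hfin)).congr' ?_
    filter_upwards [eventually_gt_atTop 0] with n hn
    simp only [div_eq_mul_inv _ (n : ℝ≥0∞)]
    exact ENNReal.mul_div_mul_right _ _ (ENNReal.inv_ne_zero.2 (ENNReal.natCast_ne_top n))
      (ENNReal.inv_ne_top.2 (by exact_mod_cast hn.ne'))
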